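/- \textbf{Proposition} (Josefson--Nissenzweig for a subclass). Let $X$ be an infinite-dimensional real Banach space which is not an Asplund space (that is, it is not the case that every continuous convex function on an open convex subset $U\subset X$ is Fréchet differentiable at each point of some dense $G_\delta$ subset of $U$). Subspaces are understood to be closed; $\mathbf{S}_X$, $\mathbf{S}_{X^*}$ are the unit spheres of $X$, $X^*$, and $\mathbf{B}_{X^*}$ is the closed unit ball of $X^*$. Suppose that $X$ satisfies at least one of the following conditions: (i) for every $x\in\mathbf{S}_X$ the set $J(x)=\{x^*\in\mathbf{S}_{X^*}: x^*(x)=1\}$ is first countable in the relative $w^*$-topology; (ii) if $Z_1,Z_2,\dots$ are subspaces of $X$ such that every quotient $X/Z_n$ is separable, then $X/\bigcap_n Z_n$ is separable; (iii) $X$ has the $1$-separable complementation property: every separable subspace $Y\subset X$ is contained in a separable subspace $Z\subset X$ which is the range of a linear projection $P\colon X\to X$ with $\|P\|\le 1$; (iv) $\mathbf{B}_{X^*}$ is $w^*$-sequentially compact. Then there is a sequence $(z_k^*)_{k\in\mathbb{N}}\subset\mathbf{S}_{X^*}$ such that $z_k^*\to 0$ in the $w^*$-topology and $0\notin\overline{\mathrm{conv}}\{z_k^*:k\in\mathbb{N}\}$,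 where the closure is taken in the norm topology of $X^*$. -/

import Mathlib

open Set Filter Topology

/-- A real Banach space is an Asplund space if every continuous convex function on an open convex
set is Fréchet differentiable at each point of some dense `Gδ` subset of that set. -/
def IsAsplundSpace (X : Type*) [NormedAddCommGroup X] [NormedSpace ℝ X] : Prop :=
  ∀ (U : Set X) (f : X → ℝ), IsOpen U → ConvexOn ℝ U f → ContinuousOn f U →
    ∃ G : Set X, G ⊆ U ∧ IsGδ G ∧ U ⊆ closure G ∧ ∀ x ∈ G, DifferentiableAt ℝ f x

/-- The duality mapping `J(x) = {x* ∈ S_{X*} : x*(x) = 1}`, as a subset of the dual equipped with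
the weak-star topology. -/
def dualityMap {X : Type*} [NormedAddCommGroup X] [NormedSpace ℝ X] (x : X) :
    Set (WeakDual ℝ X) :=
  {p | ‖WeakDual.toStrongDual p‖ = 1 ∧ p x = 1}

/-- For every `x ∈ S_X`, the set `J(x)` is first countable in the (relative) weak-star topology. -/
def DualityMapFirstCountablyValued (X : Type*) [NormedAddCommGroup X] [NormedSpace ℝ X] : Prop :=
  ∀ x : X, ‖x‖ = 1 → FirstCountableTopology (dualityMap x)

/-- A closed subspace `Z` of `X` is coseparable if the quotient `X / Z` is separable. -/
def IsCoseparable {X : Type*} [NormedAddCommGroup X] [NormedSpace ℝ X]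
    (Z : Submodule ℝ X) : Prop :=
  IsClosed (Z : Set X) ∧ TopologicalSpace.SeparableSpace (X ⧸ Z)

/-- The coseparable subspaces of `X` are preserved in countable intersections. -/
def CoseparableInterStable (X : Type*) [NormedAddCommGroup X] [NormedSpace ℝ X] : Prop :=
  ∀ Z : ℕ → Submodule ℝ X, (∀ n, IsCoseparable (Z n)) → IsCoseparable (⨅ n, Z n)

/-- The `1`-separable complementation property: every separable closed subspace is contained in
a separable closed subspace which is the range of a linear projection of norm at most one. -/
def OneSCP (X : Type*) [NormedAddCommGroup X] [NormedSpace ℝ X] : Prop :=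
  ∀ Y : Submodule ℝ X, IsClosed (Y : Set X) → TopologicalSpace.SeparableSpace Y →
    ∃ Z : Submodule ℝ X, IsClosed (Z : Set X) ∧ TopologicalSpace.SeparableSpace Z ∧ Y ≤ Z ∧
      ∃ P : X →L[ℝ] X, ‖P‖ ≤ 1 ∧ (∀ x, P x ∈ Z) ∧ ∀ z ∈ Z, P z = z

/-- The closed unit ball of the dual is weak-star sequentially compact. -/
def DualBallWeakStarSeqCompact (X : Type*) [NormedAddCommGroup X] [NormedSpace ℝ X] : Prop :=
  IsSeqCompact {p : WeakDual ℝ X | ‖WeakDual.toStrongDual p‖ ≤ 1}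

/-!
Call `X` a Grothendieck space if weak-star null sequences in its dual are weakly null. If `X` is not
Grothendieck, some weak-star null sequence `z` and some `φ` in the bidual satisfy `δ ≤ φ (z n)` along
a subsequence; after normalisation, `φ` separates the sequence from `0`, which is the conclusion
(`exists_normalized_of_not_isGrothendieckSpace`). So it suffices that a Grothendieck space satisfying
one of the four conditions is Asplund. Infinite dimension is automatic for a space that is not
Asplund.

A Banach space is Asplund if its separable closed subspaces have separable duals
(`isAsplundSpace_of_separable_dual`). If a continuous convex function has large symmetric second
differences throughout an open set, this persists on some separable closed subspace `Y`; but if the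
dual of `Y` is separable, Baire's theorem provides an open subset of `Y` on which all subgradients
are close to a single functional, which makes the second differences small there.

It remains to see that a separable closed subspace `Y` of a Grothendieck space `X` has a separable
dual. The common principle is that weak-star sequential limits are weak limits, and hence lie in the
norm closed span of the sequence. In particular weak-star compact metrizable sets of functionals on
`X` are norm separable (`IsGrothendieckSpace.exists_subset_closure_span`). Fix functionals `e n` on
`X` whose restrictions are weak-star sequentially dense in the dual unit ball of `Y`.

* If the dual ball of `X` is weak-star sequentially compact, every functional on `Y` is the
  restriction of a weak limit of a subsequence of `e`, up to scaling.
* If coseparable subspaces are stable under countable intersections, the common kernel `Z` of the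
  `e n` is coseparable, so the unit ball of its annihilator is weak-star metrizable, hence norm
  separable, and it restricts onto the dual ball of `Y`.
* If `P` is a projection of norm at most one onto a separable `Z` containing `Y`, the functionals
  `p` in the dual ball with `p ∘ P = p` form a weak-star compact metrizable set restricting onto the
  dual ball of `Y`.
* If the sets `J x` are first countable, any sequence of functionals in the dual ball that almost
  norms a unit vector has a weak-star, hence weakly, convergent subsequence. Restricting norming
  functionals of a dense sequence of `Y` to `Y`, one obtains a sequence whose closed span contains a
  norming functional of every vector of `Y`. By Simons' inequality this closed span is the whole dual
  (`closure_span_eq_top_of_norming`).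
-/

/-! ### Weak-star null sequences and the Grothendieck property -/

/-- A real normed space has the Grothendieck property if weak-star null sequences of continuous
functionals are weakly null. -/
def IsGrothendieckSpace (X : Type*) [NormedAddCommGroup X] [NormedSpace ℝ X] : Prop :=
  ∀ z : ℕ → StrongDual ℝ X, (∀ x, Tendsto (fun n => z n x) atTop (𝓝 0)) →
    ∀ φ : StrongDual ℝ (StrongDual ℝ X), Tendsto (fun n => φ (z n)) atTop (𝓝 0)

theorem IsGrothendieckSpace.tendsto_bidual {X : Type*} [NormedAddCommGroup X] [NormedSpace ℝ X]
    (hG : IsGrothendieckSpace X) {z : ℕ → StrongDual ℝ X} {p : StrongDual ℝ X}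
    (hz : ∀ x, Tendsto (fun n => z n x) atTop (𝓝 (p x))) (φ : StrongDual ℝ (StrongDual ℝ X)) :
    Tendsto (fun n => φ (z n)) atTop (𝓝 (φ p)) := by
  have h := hG (fun n => z n - p) (fun x => by simpa using (hz x).sub_const (p x)) φ
  simpa using h.add_const (φ p)

/-- A weak-star null sequence on which some element of the bidual stays above a positive constant
can be normalised, and the same element of the bidual then separates it from `0`. -/
theorem exists_normalized_of_le_bidual {X : Type*} [NormedAddCommGroup X] [NormedSpace ℝ X]
    [CompleteSpace X] {z : ℕ → StrongDual ℝ X} (hz : ∀ x, Tendsto (fun n => z n x) atTop (𝓝 0))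
    {ψ : StrongDual ℝ (StrongDual ℝ X)} {δ : ℝ} (hδ : 0 < δ) (hψ : ∀ n, δ ≤ ψ (z n)) :
    ∃ w : ℕ → StrongDual ℝ X, (∀ k, ‖w k‖ = 1) ∧
      Tendsto (fun k => StrongDual.toWeakDual (w k)) atTop (𝓝 0) ∧
      (0 : StrongDual ℝ X) ∉ closure (convexHull ℝ (range w)) := by
  have hle : ∀ n, δ ≤ ‖ψ‖ * ‖z n‖ := fun n =>
    (hψ n).trans ((le_abs_self _).trans (ψ.le_opNorm (z n)))
  have hψ0 : 0 < ‖ψ‖ := by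
    rcases (norm_nonneg ψ).eq_or_lt with h | h
    · have := hle 0
      rw [← h, zero_mul] at this
      linarith
    · exact h
  have hz0 : ∀ n, 0 < ‖z n‖ := fun n => by
    rcases (norm_nonneg (z n)).eq_or_lt with h | h
    · have := hle n
      rw [← h, mul_zero] at this
      linarith
    · exact h
  obtain ⟨M, hM⟩ : ∃ M, ∀ n, ‖z n‖ ≤ M := by
    refine banach_steinhaus (g := z) fun x => ?_
    obtain ⟨C, hC⟩ := (hz x).norm.bddAbove_range
    exact ⟨C, fun n => hC ⟨n, rfl⟩⟩
  have hM0 : 0 < M := (hz0 0).trans_le (hM 0)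
  refine ⟨fun n => ‖z n‖⁻¹ • z n, fun k => ?_, ?_, fun h0 => ?_⟩
  · rw [norm_smul, norm_inv, norm_norm, inv_mul_cancel₀ (hz0 k).ne']
  · rw [tendsto_iff_forall_eval_tendsto_topDualPairing]
    intro x
    have hb : ∀ n, ‖(‖z n‖⁻¹ • z n) x‖ ≤ ‖ψ‖ / δ * ‖z n x‖ := fun n => by
      rw [smul_apply, norm_smul, norm_inv, norm_norm]
      refine mul_le_mul_of_nonneg_right ?_ (norm_nonneg _)
      rw [inv_le_comm₀ (hz0 n) (by positivity), inv_div, div_le_iff₀ hψ0, mul_comm]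
      exact hle n
    refine squeeze_zero_norm hb ?_
    simpa using ((hz x).norm.const_mul (‖ψ‖ / δ))
  · have hcl : closure (convexHull ℝ (range fun n => ‖z n‖⁻¹ • z n)) ⊆ {p | δ / M ≤ ψ p} := by
      refine closure_minimal (convexHull_min ?_ ?_) (isClosed_le continuous_const ψ.continuous)
      · rintro _ ⟨n, rfl⟩
        simp only [mem_ofPred_eq, map_smul, smul_eq_mul]
        rw [inv_mul_eq_div]
        exact div_le_div₀ (hδ.le.trans (hψ n)) (hψ n) (hz0 n) (hM n)
      · exact convex_halfSpace_ge ψ.toLinearMap.isLinear _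
    have := hcl h0
    simp only [mem_ofPred_eq, map_zero] at this
    exact absurd this (not_le.2 (by positivity))

theorem exists_normalized_of_not_isGrothendieckSpace {X : Type*} [NormedAddCommGroup X]
    [NormedSpace ℝ X] [CompleteSpace X] (hG : ¬ IsGrothendieckSpace X) :
    ∃ w : ℕ → StrongDual ℝ X, (∀ k, ‖w k‖ = 1) ∧
      Tendsto (fun k => StrongDual.toWeakDual (w k)) atTop (𝓝 0) ∧
      (0 : StrongDual ℝ X) ∉ closure (convexHull ℝ (range w)) := by
  unfold IsGrothendieckSpace at hG
  push Not at hG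
  obtain ⟨z, hz, φ, hφ⟩ := hG
  rw [Metric.tendsto_atTop] at hφ
  push Not at hφ
  obtain ⟨δ, hδ, hφ⟩ := hφ
  have hfr : ∃ᶠ n in atTop, δ ≤ |φ (z n)| := by
    rw [frequently_atTop]
    intro N
    obtain ⟨n, hn, h⟩ := hφ N
    exact ⟨n, hn, by simpa using h⟩
  have hfr' : (∃ᶠ n in atTop, δ ≤ φ (z n)) ∨ ∃ᶠ n in atTop, δ ≤ (-φ) (z n) := by
    rw [← frequently_or_distrib]
    exact hfr.mono fun n hn => by simpa using le_abs.1 hn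
  rcases hfr' with h | h
  all_goals
    obtain ⟨s, hs, hsψ⟩ := extraction_of_frequently_atTop h
    exact exists_normalized_of_le_bidual (z := z ∘ s)
      (fun x => (hz x).comp hs.tendsto_atTop) hδ hsψ

theorem exists_dual_eq_zero_of_notMem {E : Type*} [NormedAddCommGroup E] [NormedSpace ℝ E]
    {W : Submodule ℝ E} (hW : IsClosed (W : Set E)) {x : E} (hx : x ∉ W) :
    ∃ f : StrongDual ℝ E, (∀ w ∈ W, f w = 0) ∧ f x ≠ 0 := by
  obtain ⟨f, u, hfx, hfW⟩ := geometric_hahn_banach_point_closed W.convex hW hx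
  have h0 : u < 0 := by simpa using hfW 0 W.zero_mem
  refine ⟨f, fun w hw => ?_, (hfx.trans h0).ne⟩
  by_contra hne
  have := hfW ((u / f w) • w) (W.smul_mem _ hw)
  rw [map_smul, smul_eq_mul, div_mul_cancel₀ _ hne] at this
  exact lt_irrefl _ this

/-- Weak limits of sequences in a norm closed subspace stay in the subspace. -/
theorem mem_of_tendsto_dual {E : Type*} [NormedAddCommGroup E] [NormedSpace ℝ E]
    {W : Submodule ℝ E} (hW : IsClosed (W : Set E)) {u : ℕ → E} (hu : ∀ n, u n ∈ W) {x : E}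
    (h : ∀ f : StrongDual ℝ E, Tendsto (fun n => f (u n)) atTop (𝓝 (f x))) : x ∈ W := by
  by_contra hx
  obtain ⟨f, hfW, hfx⟩ := exists_dual_eq_zero_of_notMem hW hx
  refine hfx (tendsto_nhds_unique (h f) ?_)
  simp [hfW _ (hu _)]

theorem isSeparable_closure_span_range {E : Type*} [NormedAddCommGroup E] [NormedSpace ℝ E]
    (d : ℕ → E) :
    TopologicalSpace.IsSeparable
      ((Submodule.span ℝ (range d)).topologicalClosure : Set E) := by
  rw [Submodule.topologicalClosure_coe]
  exact ((countable_range d).isSeparable.span (R := ℝ)).closure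

/-! ### Norm separability of weak-star compact sets -/

/-- If countably many points of `X` separate the points of a weak-star compact set of functionals,
that set is metrizable, hence contains a weak-star sequentially dense sequence. -/
theorem exists_seq_forall_exists_tendsto {X : Type*} [NormedAddCommGroup X] [NormedSpace ℝ X]
    {K : Set (WeakDual ℝ X)} (hK : IsCompact K) (hne : K.Nonempty) {x : ℕ → X}
    (hx : ∀ p ∈ K, ∀ q ∈ K, (∀ n, p (x n) = q (x n)) → p = q) :
    ∃ d : ℕ → WeakDual ℝ X, (∀ n, d n ∈ K) ∧
      ∀ p ∈ K, ∃ s : ℕ → ℕ, Tendsto (d ∘ s) atTop (𝓝 p) := by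
  have : CompactSpace K := isCompact_iff_compactSpace.mp hK
  have : Nonempty K := hne.to_subtype
  have : TopologicalSpace.MetrizableSpace K :=
    Metric.PiNatEmbed.TopologicalSpace.MetrizableSpace.of_countable_separating
      (fun n (k : K) ↦ (k : WeakDual ℝ X) (x n))
      (fun n ↦ (WeakDual.eval_continuous (x n)).comp continuous_subtype_val)
      fun p q hpq ↦ by
        by_contra! h
        exact hpq (Subtype.ext (hx p p.2 q q.2 h))
  let _ := TopologicalSpace.metrizableSpaceMetric K
  refine ⟨fun n => TopologicalSpace.denseSeq K n, fun n => Subtype.coe_prop _, fun p hp => ?_⟩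
  obtain ⟨u, hu, hlim⟩ := mem_closure_iff_seq_limit.1
    (TopologicalSpace.denseRange_denseSeq K (⟨p, hp⟩ : K))
  choose s hs using hu
  refine ⟨s, ?_⟩
  have := (continuous_subtype_val.tendsto _).comp hlim
  refine this.congr fun n => ?_
  simp [← hs]

/-- In a Grothendieck space, weak-star compact metrizable sets of functionals are norm
separable. -/
theorem IsGrothendieckSpace.exists_subset_closure_span {X : Type*} [NormedAddCommGroup X]
    [NormedSpace ℝ X] (hG : IsGrothendieckSpace X)
    {K : Set (WeakDual ℝ X)} (hK : IsCompact K) (hne : K.Nonempty) {x : ℕ → X}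
    (hx : ∀ p ∈ K, ∀ q ∈ K, (∀ n, p (x n) = q (x n)) → p = q) :
    ∃ d : ℕ → StrongDual ℝ X, ∀ p ∈ K,
      WeakDual.toStrongDual p ∈ (Submodule.span ℝ (range d)).topologicalClosure := by
  obtain ⟨d, -, hd⟩ := exists_seq_forall_exists_tendsto hK hne hx
  refine ⟨fun n => WeakDual.toStrongDual (d n), fun p hp => ?_⟩
  obtain ⟨s, hs⟩ := hd p hp
  rw [tendsto_iff_forall_eval_tendsto_topDualPairing] at hs
  refine mem_of_tendsto_dual (Submodule.isClosed_topologicalClosure _)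
    (u := fun k => WeakDual.toStrongDual (d (s k)))
    (fun k => Submodule.le_topologicalClosure _ (Submodule.subset_span (mem_range_self (s k))))
    fun φ => hG.tendsto_bidual (fun y => hs y) φ

/-! ### Restriction to isometrically embedded spaces -/

/-- The restriction of functionals on `X` to an isometrically embedded normed space `F`. -/
noncomputable def restrictDual {X F : Type*} [NormedAddCommGroup X] [NormedSpace ℝ X]
    [NormedAddCommGroup F] [NormedSpace ℝ F] (i : F →ₗᵢ[ℝ] X) :
    StrongDual ℝ X →L[ℝ] StrongDual ℝ F :=
  (ContinuousLinearMap.compL ℝ F X ℝ).flip i.toContinuousLinearMap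

@[simp]
theorem restrictDual_apply {X F : Type*} [NormedAddCommGroup X] [NormedSpace ℝ X]
    [NormedAddCommGroup F] [NormedSpace ℝ F] (i : F →ₗᵢ[ℝ] X) (p : StrongDual ℝ X) (y : F) :
    restrictDual i p y = p (i y) := rfl

/-- Hahn-Banach extension along an isometric embedding. -/
theorem exists_restrictDual_eq {X F : Type*} [NormedAddCommGroup X] [NormedSpace ℝ X]
    [NormedAddCommGroup F] [NormedSpace ℝ F] (i : F →ₗᵢ[ℝ] X) (q : StrongDual ℝ F) :
    ∃ p : StrongDual ℝ X, restrictDual i p = q ∧ ‖p‖ ≤ ‖q‖ := by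
  obtain ⟨p, hp, hpn⟩ := exists_extension_norm_eq (LinearMap.range i.toLinearMap)
    (q.comp (i.equivRange.symm.toLinearIsometry.toContinuousLinearMap))
  refine ⟨p, ?_, hpn.trans_le ((ContinuousLinearMap.opNorm_comp_le _ _).trans ?_)⟩
  · ext y
    have := hp (i.equivRange y)
    simpa using this
  · exact mul_le_of_le_one_right (norm_nonneg _) (LinearIsometry.norm_toContinuousLinearMap_le _)

theorem separableSpace_dual_of_forall_exists_restrict {X F : Type*} [NormedAddCommGroup X]
    [NormedSpace ℝ X] [NormedAddCommGroup F] [NormedSpace ℝ F] {i : F →ₗᵢ[ℝ] X}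
    (d : ℕ → StrongDual ℝ X)
    (h : ∀ q : StrongDual ℝ F, ‖q‖ ≤ 1 →
      ∃ p ∈ (Submodule.span ℝ (range d)).topologicalClosure, restrictDual i p = q) :
    TopologicalSpace.SeparableSpace (StrongDual ℝ F) := by
  rw [← TopologicalSpace.isSeparable_univ_iff]
  refine ((isSeparable_closure_span_range d).image (restrictDual i).continuous).mono ?_
  intro q _
  rcases eq_or_ne q 0 with rfl | hq
  · exact ⟨0, Submodule.zero_mem _, by simp⟩
  · obtain ⟨p, hp, hpq⟩ := h (‖q‖⁻¹ • q) (by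
      rw [norm_smul, norm_inv, norm_norm, inv_mul_cancel₀ (norm_ne_zero_iff.2 hq)])
    refine ⟨‖q‖ • p, Submodule.smul_mem _ _ hp, ?_⟩
    rw [map_smul, hpq, smul_smul, mul_inv_cancel₀ (norm_ne_zero_iff.2 hq), one_smul]

theorem isCompact_dual_unitBall (X : Type*) [NormedAddCommGroup X] [NormedSpace ℝ X] :
    IsCompact {p : WeakDual ℝ X | ‖WeakDual.toStrongDual p‖ ≤ 1} := by
  convert WeakDual.isCompact_closedBall (0 : StrongDual ℝ X) 1 using 1
  ext p
  simp

/-- The dual unit ball of a separable space contains a weak-star sequentially dense sequence. -/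
theorem exists_seq_dual_unitBall (Y : Type*) [NormedAddCommGroup Y] [NormedSpace ℝ Y]
    [TopologicalSpace.SeparableSpace Y] :
    ∃ d : ℕ → StrongDual ℝ Y, (∀ n, ‖d n‖ ≤ 1) ∧ ∀ q : StrongDual ℝ Y, ‖q‖ ≤ 1 →
      ∃ s : ℕ → ℕ, ∀ y, Tendsto (fun k => d (s k) y) atTop (𝓝 (q y)) := by
  obtain ⟨d, hd, hd'⟩ := exists_seq_forall_exists_tendsto (isCompact_dual_unitBall Y)
    ⟨0, by simp⟩ (x := TopologicalSpace.denseSeq Y) fun p _ q _ h =>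
      DFunLike.ext'_iff.mpr <| (map_continuous p).ext_on
        (TopologicalSpace.denseRange_denseSeq Y) (map_continuous q)
        (Set.eqOn_range.mpr (funext h))
  refine ⟨fun n => WeakDual.toStrongDual (d n), hd, fun q hq => ?_⟩
  obtain ⟨s, hs⟩ := hd' (StrongDual.toWeakDual q) hq
  rw [tendsto_iff_forall_eval_tendsto_topDualPairing] at hs
  exact ⟨s, hs⟩

/-! ### Subgradients and Asplund spaces -/

/-- A continuous convex function on an open set has a subgradient at every point. -/
theorem ConvexOn.exists_subgradient {X : Type*} [NormedAddCommGroup X] [NormedSpace ℝ X]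
    {U : Set X} {f : X → ℝ} (hU : IsOpen U) (hf : ConvexOn ℝ U f) (hc : ContinuousOn f U)
    {x : X} (hx : x ∈ U) :
    ∃ p : StrongDual ℝ X, ∀ y ∈ U, f x + p (y - x) ≤ f y := by
  let S : Set (X × ℝ) := {a | a.1 ∈ U ∧ f a.1 < a.2}
  have hSc : Convex ℝ S := hf.convex_strict_epigraph
  have hSo : IsOpen S := by
    have h1 : ContinuousOn (fun a : X × ℝ => a.2 - f a.1) (U ×ˢ univ) :=
      continuousOn_snd.sub (hc.comp continuousOn_fst fun a ha => ha.1)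
    convert h1.isOpen_inter_preimage (hU.prod isOpen_univ) (isOpen_Ioi (a := (0 : ℝ))) using 1
    ext a
    simp [S]
  obtain ⟨F, hF⟩ := geometric_hahn_banach_open_point hSc hSo
    (x := (x, f x)) (fun h => lt_irrefl _ h.2)
  -- the separating functional is `(y, t) ↦ g y + c * t`, and `c < 0`
  set g : StrongDual ℝ X := F.comp (ContinuousLinearMap.inl ℝ X ℝ) with hg
  set c : ℝ := F (0, 1) with hcdef
  have hdec : ∀ y t, F (y, t) = g y + c * t := fun y t => by
    have : (y, t) = (y, (0 : ℝ)) + t • ((0 : X), (1 : ℝ)) := by simp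
    rw [this, map_add, map_smul, smul_eq_mul, mul_comm]
    rfl
  have hc0 : c < 0 := by
    have := hF (x, f x + 1) ⟨hx, by simp⟩
    rw [hdec, hdec] at this
    linarith
  refine ⟨(-c)⁻¹ • g, fun y hy => ?_⟩
  have h1 : g y + c * f y ≤ g x + c * f x := by
    refine le_of_forall_pos_lt_add fun ε hε => ?_
    have := hF (y, f y + ε / (-c)) ⟨hy, by simpa using div_pos hε (neg_pos.2 hc0)⟩
    rw [hdec, hdec] at this
    have h2 : c * (ε / (-c)) = -ε := by
      rw [div_neg, mul_neg, mul_div_cancel₀ _ hc0.ne]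
    linarith [mul_add c (f y) (ε / -c)]
  have h3 : (-c)⁻¹ * (g (y - x)) ≤ f y - f x := by
    rw [inv_mul_le_iff₀ (neg_pos.2 hc0), map_sub]
    linarith
  simp only [smul_apply, smul_eq_mul]
  linarith

/-- A functional bounded by `C * ‖h‖` on vectors of one fixed positive norm is so bounded
everywhere. -/
theorem le_mul_norm_of_sphere {X : Type*} [NormedAddCommGroup X] [NormedSpace ℝ X]
    {p : StrongDual ℝ X} {s C : ℝ} (hs : 0 < s) (h : ∀ v : X, ‖v‖ = s → p v ≤ C * s) (v : X) :
    p v ≤ C * ‖v‖ := by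
  rcases eq_or_ne v 0 with rfl | hv
  · simp
  have hv' : 0 < ‖v‖ := norm_pos_iff.2 hv
  have := h ((s / ‖v‖) • v) (by
    rw [norm_smul, Real.norm_of_nonneg (by positivity)]; field_simp)
  rw [map_smul, smul_eq_mul, div_mul_eq_mul_div, div_le_iff₀ hv'] at this
  have : s * p v ≤ s * (C * ‖v‖) := by linarith
  exact le_of_mul_le_mul_left this hs

/-- The points of `U` near which `f` differs from a continuous linear functional by an
`ε`-Lipschitz function. Only one inequality is required, since the two points may be exchanged. -/
def nearlyLinearSet {X : Type*} [NormedAddCommGroup X] [NormedSpace ℝ X]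
    (U : Set X) (f : X → ℝ) (ε : ℝ) : Set X :=
  {x | ∃ r > 0, Metric.ball x r ⊆ U ∧ ∃ p : StrongDual ℝ X,
    ∀ y ∈ Metric.ball x r, ∀ z ∈ Metric.ball x r, f y + p (z - y) - ε * ‖z - y‖ ≤ f z}

theorem isOpen_nearlyLinearSet {X : Type*} [NormedAddCommGroup X] [NormedSpace ℝ X]
    (U : Set X) (f : X → ℝ) (ε : ℝ) : IsOpen (nearlyLinearSet U f ε) := by
  rw [Metric.isOpen_iff]
  rintro x ⟨r, hr, hrU, p, hp⟩
  refine ⟨r / 2, by positivity, fun y hy => ?_⟩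
  have hsub : Metric.ball y (r / 2) ⊆ Metric.ball x r := by
    apply Metric.ball_subset_ball'
    have := Metric.mem_ball.1 hy
    linarith
  exact ⟨r / 2, by positivity, hsub.trans hrU, p, fun a ha b hb => hp a (hsub ha) b (hsub hb)⟩

/-- The local almost-linear approximations at `x` are all norm close to the subgradient `p`, which
is therefore the derivative. -/
theorem differentiableAt_of_forall_mem_nearlyLinearSet {X : Type*} [NormedAddCommGroup X]
    [NormedSpace ℝ X] {U : Set X} {f : X → ℝ} {x : X} {p : StrongDual ℝ X}
    (hp : ∀ y ∈ U, f x + p (y - x) ≤ f y) (hx : ∀ ε > 0, x ∈ nearlyLinearSet U f ε) :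
    DifferentiableAt ℝ f x := by
  refine HasFDerivAt.differentiableAt (f' := p) ?_
  rw [hasFDerivAt_iff_isLittleO_nhds_zero, Asymptotics.isLittleO_iff]
  intro c hc
  obtain ⟨r, hr, hrU, q, hq⟩ := hx (c / 2) (by positivity)
  have hxb : x ∈ Metric.ball x r := Metric.mem_ball_self hr
  have hball : ∀ v : X, ‖v‖ < r → x + v ∈ Metric.ball x r := fun v hv => by simpa using hv
  have hpq : ∀ v, (p - q) v ≤ c / 2 * ‖v‖ := by
    refine le_mul_norm_of_sphere (s := r / 2) (by positivity) fun v hv => ?_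
    have hv' := hball v (by linarith)
    have h1 := hp _ (hrU hv')
    have h2 := hq _ hv' _ hxb
    have e : x - (x + v) = -v := by abel
    rw [e, map_neg, norm_neg, hv] at h2
    rw [add_sub_cancel_left] at h1
    simp only [sub_apply]
    linarith
  filter_upwards [Metric.ball_mem_nhds (0 : X) hr] with v hv
  have hv' := hball v (by simpa using hv)
  have h1 := hp _ (hrU hv')
  have h2 := hq _ hv' _ hxb
  have e : x - (x + v) = -v := by abel
  rw [e, map_neg, norm_neg] at h2
  rw [add_sub_cancel_left] at h1
  have h3 := hpq (-v)
  simp only [sub_apply, map_neg, norm_neg] at h3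
  rw [Real.norm_of_nonneg (by linarith)]
  linarith

/-- A point with small symmetric second differences lies in `nearlyLinearSet`: the subgradients at
nearby points are norm close to the subgradient at the point itself. -/
theorem mem_nearlyLinearSet_of_second_difference_le {X : Type*} [NormedAddCommGroup X]
    [NormedSpace ℝ X] {U : Set X} {f : X → ℝ} (hU : IsOpen U) (hf : ConvexOn ℝ U f)
    (hc : ContinuousOn f U) {x : X} {ε r : ℝ} (hε : 0 ≤ ε) (hr : 0 < r)
    (hrU : Metric.ball x r ⊆ U)
    (h : ∀ v : X, ‖v‖ < r → f (x + v) + f (x - v) - 2 * f x ≤ ε * ‖v‖) :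
    x ∈ nearlyLinearSet U f (2 * ε) := by
  have hx : x ∈ U := hrU (Metric.mem_ball_self hr)
  obtain ⟨p, hp⟩ := hf.exists_subgradient hU hc hx
  refine ⟨r / 3, by positivity, (Metric.ball_subset_ball (by linarith)).trans hrU, p, ?_⟩
  intro y hy z hz
  have hyU := hrU (Metric.ball_subset_ball (by linarith) hy)
  have hzU := hrU (Metric.ball_subset_ball (by linarith) hz)
  obtain ⟨q, hq⟩ := hf.exists_subgradient hU hc hyU
  have hyx : ‖y - x‖ < r / 3 := by simpa [dist_eq_norm] using hy
  have hqp : ∀ v, (q - p) v ≤ 2 * ε * ‖v‖ := by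
    refine le_mul_norm_of_sphere (s := r / 3) (by positivity) fun v hv => ?_
    set w := v + (y - x) with hw
    have hwn : ‖w‖ ≤ r / 3 + ‖y - x‖ := (norm_add_le _ _).trans (by rw [hv])
    have hwr : ‖w‖ < r := by linarith
    have hyv : y + v = x + w := by rw [hw]; abel
    have h1 := hq (y + v) (hrU (by rw [hyv]; simpa using hwr))
    have h2 := h w hwr
    have h3 := hp (x - w) (hrU (by simpa using hwr))
    have h4 := hp y hyU
    rw [add_sub_cancel_left, hyv] at h1
    have e : x - w - x = -w := by abel
    rw [e, map_neg] at h3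
    have h5 : p w = p v + p (y - x) := by rw [hw, map_add]
    have h6 : ε * ‖w‖ ≤ ε * (2 * (r / 3)) := mul_le_mul_of_nonneg_left (by linarith) hε
    simp only [sub_apply]
    linarith
  have h1 := hq z hzU
  have h2 := hqp (-(z - y))
  simp only [sub_apply, map_neg, norm_neg] at h2
  linarith

/-- If the dual of `F` is separable, Baire's theorem yields an open set on which all subgradients
of `f` are close to a single functional. -/
theorem exists_open_forall_subgradient_near {F : Type*} [NormedAddCommGroup F] [NormedSpace ℝ F]
    [CompleteSpace F] [TopologicalSpace.SeparableSpace (StrongDual ℝ F)] {V : Set F} {f : F → ℝ}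
    (hV : IsOpen V) (hne : V.Nonempty) (hc : ContinuousOn f V)
    (hsub : ∀ y ∈ V, ∃ q : StrongDual ℝ F, ∀ z ∈ V, f y + q (z - y) ≤ f z)
    {ε : ℝ} (hε : 0 < ε) :
    ∃ V' ⊆ V, IsOpen V' ∧ V'.Nonempty ∧ ∃ q : StrongDual ℝ F,
      ∀ y ∈ V', ∀ z ∈ V', f y + q (z - y) - ε * ‖z - y‖ ≤ f z := by
  let d := TopologicalSpace.denseSeq (StrongDual ℝ F)
  let A : ℕ → Set F := fun k => {y | ∀ z ∈ V, f y + d k (z - y) - ε * ‖z - y‖ ≤ f z}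
  have hcov : ∀ y ∈ V, ∃ k, y ∈ A k := fun y hy => by
    obtain ⟨q, hq⟩ := hsub y hy
    obtain ⟨k, hk⟩ := (TopologicalSpace.denseRange_denseSeq (StrongDual ℝ F)).exists_dist_lt q hε
    refine ⟨k, fun z hz => ?_⟩
    have h1 := hq z hz
    have h2 : (d k - q) (z - y) ≤ ε * ‖z - y‖ := by
      refine (le_abs_self _).trans (((d k - q).le_opNorm _).trans ?_)
      refine mul_le_mul_of_nonneg_right ?_ (norm_nonneg _)
      rw [← dist_eq_norm, dist_comm]
      exact hk.le
    simp only [sub_apply] at h2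
    linarith
  have hdense := dense_iUnion_interior_of_closed (f := fun k => closure (A k) ∪ Vᶜ)
    (fun k => isClosed_closure.union hV.isClosed_compl) (by
      refine eq_univ_of_forall fun y => mem_iUnion.2 ?_
      by_cases hy : y ∈ V
      · obtain ⟨k, hk⟩ := hcov y hy
        exact ⟨k, Or.inl (subset_closure hk)⟩
      · exact ⟨0, Or.inr hy⟩)
  obtain ⟨y₀, hy₀, hy₀V⟩ := hdense.inter_open_nonempty V hV hne |>.imp fun _ h => h.symm
  obtain ⟨k, hk⟩ := mem_iUnion.1 hy₀
  refine ⟨V ∩ interior (closure (A k) ∪ Vᶜ), inter_subset_left, hV.inter isOpen_interior,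
    ⟨y₀, hy₀V, hk⟩, d k, fun y hy z hz => ?_⟩
  have hyA : y ∈ closure (A k) := (interior_subset hy.2).resolve_right fun h => h hy.1
  have : (𝓝[A k] y).NeBot := mem_closure_iff_nhdsWithin_neBot.1 hyA
  have hfy : ContinuousAt f y := hc.continuousAt (hV.mem_nhds hy.1)
  have hlim : Tendsto (fun y => f y + d k (z - y) - ε * ‖z - y‖) (𝓝[A k] y)
      (𝓝 (f y + d k (z - y) - ε * ‖z - y‖)) := by
    have : ContinuousAt (fun y => f y + d k (z - y) - ε * ‖z - y‖) y := by fun_prop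
    exact this.tendsto.mono_left nhdsWithin_le_nhds
  exact le_of_tendsto hlim (eventually_nhdsWithin_of_forall fun a ha => ha z hz.1)

/-- Given countably many self-maps of a normed space, every point lies in a separable closed
subspace with a dense subset that contains the point and is invariant under all the maps. This
serves the separable reduction. -/
theorem exists_separable_submodule_invariant {X : Type*} [NormedAddCommGroup X] [NormedSpace ℝ X]
    (v : X) (H : ℕ → X → X) :
    ∃ (Y : Submodule ℝ X) (A : Set X), IsClosed (Y : Set X) ∧
      TopologicalSpace.SeparableSpace Y ∧ (Y : Set X) = closure A ∧ v ∈ A ∧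
      ∀ a ∈ A, ∀ k, H k a ∈ A := by
  -- `A` is the closure of `{v}` under sums, rational multiples and the maps `H k`
  let Φ : Set X → Set X := fun S =>
    S ∪ (image2 (· + ·) S S ∪ ((⋃ q : ℚ, (fun x => (q : ℝ) • x) '' S) ∪ ⋃ k, H k '' S))
  let S : ℕ → Set X := fun n => Φ^[n] {v}
  have hS : ∀ n, S (n + 1) = Φ (S n) := fun n => Function.iterate_succ_apply' Φ n {v}
  have hmono : Monotone S := monotone_nat_of_le_succ fun n => by
    rw [hS]
    exact subset_union_left
  have hcount : ∀ n, (S n).Countable := by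
    intro n
    induction n with
    | zero => exact countable_singleton v
    | succ n ih =>
      rw [hS]
      exact ih.union ((ih.image2 ih _).union
        ((countable_iUnion fun q => ih.image _).union (countable_iUnion fun k => ih.image _)))
  set A : Set X := ⋃ n, S n with hA
  have hadd : ∀ a ∈ A, ∀ b ∈ A, a + b ∈ A := by
    intro a ha b hb
    obtain ⟨n, hn⟩ := mem_iUnion.1 ha
    obtain ⟨m, hm⟩ := mem_iUnion.1 hb
    refine mem_iUnion.2 ⟨max n m + 1, ?_⟩
    rw [hS]
    exact Or.inr (Or.inl ⟨a, hmono (le_max_left n m) hn, b, hmono (le_max_right n m) hm, rfl⟩)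
  have hsmul : ∀ (q : ℚ), ∀ a ∈ A, (q : ℝ) • a ∈ A := by
    intro q a ha
    obtain ⟨n, hn⟩ := mem_iUnion.1 ha
    refine mem_iUnion.2 ⟨n + 1, ?_⟩
    rw [hS]
    exact Or.inr (Or.inr (Or.inl (mem_iUnion.2 ⟨q, a, hn, rfl⟩)))
  have hH : ∀ a ∈ A, ∀ k, H k a ∈ A := by
    intro a ha k
    obtain ⟨n, hn⟩ := mem_iUnion.1 ha
    refine mem_iUnion.2 ⟨n + 1, ?_⟩
    rw [hS]
    exact Or.inr (Or.inr (Or.inr (mem_iUnion.2 ⟨k, a, hn, rfl⟩)))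
  have hv : v ∈ A := mem_iUnion.2 ⟨0, rfl⟩
  let Y : Submodule ℝ X :=
    { carrier := closure A
      add_mem' := fun {a b} ha hb => map_mem_closure₂ continuous_add ha hb hadd
      zero_mem' := subset_closure (by simpa using hsmul 0 v hv)
      smul_mem' := fun c a ha => by
        refine map_mem_closure₂ (f := fun (c : ℝ) (a : X) => c • a) continuous_smul
          (s := range ((↑) : ℚ → ℝ)) (Rat.isDenseEmbedding_coe_real.dense c) ha ?_
        rintro _ ⟨q, rfl⟩ a ha
        exact hsmul q a ha }
  refine ⟨Y, A, isClosed_closure, ?_, rfl, hv, hH⟩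
  exact ((countable_iUnion hcount).isSeparable.closure).separableSpace

/-- Separable reduction together with Baire's theorem in the separable subspace: points with
large second differences cannot fill an open set. -/
theorem dense_nearlyLinearSet {X : Type*} [NormedAddCommGroup X] [NormedSpace ℝ X]
    [CompleteSpace X]
    (hX : ∀ Y : Submodule ℝ X, IsClosed (Y : Set X) → TopologicalSpace.SeparableSpace Y →
      TopologicalSpace.SeparableSpace (StrongDual ℝ Y))
    {U : Set X} {f : X → ℝ} (hU : IsOpen U) (hf : ConvexOn ℝ U f) (hc : ContinuousOn f U)
    {ε : ℝ} (hε : 0 < ε) : U ⊆ closure (nearlyLinearSet U f (2 * ε)) := by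
  intro v₀ hv₀
  by_contra hcon
  set V : Set X := U ∩ (closure (nearlyLinearSet U f (2 * ε)))ᶜ with hVdef
  have hV : IsOpen V := hU.inter isClosed_closure.isOpen_compl
  -- at every point of `V` and at every scale some symmetric second difference is large
  have hbad : ∀ (k : ℕ) (x : X), ∃ y : X, x ∈ V → ‖y - x‖ < ((k : ℝ) + 1)⁻¹ ∧
      ε * ‖y - x‖ < f (x + (y - x)) + f (x - (y - x)) - 2 * f x := by
    intro k x
    by_cases hx : x ∈ V
    · obtain ⟨r, hr, hrU⟩ := Metric.isOpen_iff.1 hU x hx.1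
      have hnot : x ∉ nearlyLinearSet U f (2 * ε) := fun h => hx.2 (subset_closure h)
      by_contra! hall
      refine hnot (mem_nearlyLinearSet_of_second_difference_le hU hf hc hε.le
        (r := min r ((k : ℝ) + 1)⁻¹) (lt_min hr (by positivity))
        ((Metric.ball_subset_ball (min_le_left _ _)).trans hrU) fun w hw => ?_)
      have := (hall (x + w)).2
      rw [add_sub_cancel_left] at this
      exact this (hw.trans_le (min_le_right _ _))
    · exact ⟨0, fun h => absurd h hx⟩
  choose H hH using hbad
  obtain ⟨Y, A, hYc, hYs, hYA, hvA, hHA⟩ := exists_separable_submodule_invariant v₀ H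
  have hAY : A ⊆ Y := by rw [hYA]; exact subset_closure
  have := hX Y hYc hYs
  have : CompleteSpace Y := hYc.completeSpace_coe
  let g : Y → ℝ := fun y => f y
  let VY : Set Y := ((↑) : Y → X) ⁻¹' V
  obtain ⟨V', hV'sub, hV'o, ⟨y₀, hy₀⟩, q, hq⟩ := exists_open_forall_subgradient_near (V := VY)
    (f := g) (hV.preimage continuous_subtype_val) ⟨⟨v₀, hAY hvA⟩, hv₀, hcon⟩
    ((hc.mono inter_subset_left).comp continuous_subtype_val.continuousOn fun y hy => hy)
    (fun y hy => by
      obtain ⟨p, hp⟩ := hf.exists_subgradient hU hc (x := (y : X)) hy.1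
      exact ⟨p.comp Y.subtypeL, fun z hz => hp z hz.1⟩) (half_pos hε)
  -- a point of the countable dense set in `V'`
  obtain ⟨a, haA, haV'⟩ : ∃ a : Y, (a : X) ∈ A ∧ a ∈ V' := by
    obtain ⟨O, hO, hOV'⟩ := isOpen_induced_iff.1 hV'o
    have hy₀O : (y₀ : X) ∈ O := by rw [← hOV'] at hy₀; exact hy₀
    have : (y₀ : X) ∈ closure A := by rw [← hYA]; exact y₀.2
    obtain ⟨a, haO, haA⟩ := mem_closure_iff.1 this O hO hy₀O
    exact ⟨⟨a, hAY haA⟩, haA, by rw [← hOV']; exact haO⟩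
  obtain ⟨r, hr, hrV'⟩ := Metric.isOpen_iff.1 hV'o a haV'
  obtain ⟨k, hk⟩ := exists_nat_one_div_lt hr
  obtain ⟨h1, h2⟩ := hH k a (hV'sub haV')
  let w : Y := ⟨H k a, hAY (hHA a haA k)⟩ - a
  have hw : ‖w‖ < r := by
    refine lt_trans ?_ hk
    simpa [w] using h1
  have hp := hq (a + w) (hrV' (by simpa using hw)) a haV'
  have hm := hq (a - w) (hrV' (by simpa using hw)) a haV'
  have e : a - (a + w) = -w := by abel
  rw [e, map_neg, norm_neg] at hp
  rw [sub_sub_cancel] at hm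
  have h3 : ε * ‖w‖ < g (a + w) + g (a - w) - 2 * g a := h2
  linarith

/-- A Banach space all of whose separable closed subspaces have separable duals is Asplund. -/
theorem isAsplundSpace_of_separable_dual {X : Type*} [NormedAddCommGroup X] [NormedSpace ℝ X]
    [CompleteSpace X]
    (hX : ∀ Y : Submodule ℝ X, IsClosed (Y : Set X) → TopologicalSpace.SeparableSpace Y →
      TopologicalSpace.SeparableSpace (StrongDual ℝ Y)) : IsAsplundSpace X := by
  intro U f hU hf hc
  let ε : ℕ → ℝ := fun n => 2 * (1 / ((n : ℝ) + 1))
  refine ⟨U ∩ ⋂ n, nearlyLinearSet U f (ε n), inter_subset_left,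
    hU.isGδ.inter (.iInter_of_isOpen fun n => isOpen_nearlyLinearSet _ _ _), ?_, ?_⟩
  · -- adding the exterior of `U` makes the open sets dense in the whole space
    have hd : Dense (⋂ n, (nearlyLinearSet U f (ε n) ∪ (closure U)ᶜ)) := by
      refine dense_iInter_of_isOpen
        (fun n => (isOpen_nearlyLinearSet _ _ _).union isClosed_closure.isOpen_compl) fun n => ?_
      intro x
      rw [closure_union]
      by_cases hx : x ∈ closure U
      · exact Or.inl (closure_minimal (dense_nearlyLinearSet hX hU hf hc
          (ε := 1 / ((n : ℝ) + 1)) (by positivity)) isClosed_closure hx)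
      · exact Or.inr (subset_closure hx)
    intro x hx
    rw [mem_closure_iff]
    intro O hO hxO
    obtain ⟨y, ⟨hyO, hyU⟩, hy⟩ := hd.inter_open_nonempty (O ∩ U) (hO.inter hU) ⟨x, hxO, hx⟩
    exact ⟨y, hyO, hyU, mem_iInter.2 fun n =>
      (mem_iInter.1 hy n).resolve_right fun h => h (subset_closure hyU)⟩
  · rintro x ⟨hxU, hx⟩
    obtain ⟨p, hp⟩ := hf.exists_subgradient hU hc hxU
    refine differentiableAt_of_forall_mem_nearlyLinearSet hp fun δ hδ => ?_
    obtain ⟨n, hn⟩ := exists_nat_one_div_lt (half_pos hδ)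
    obtain ⟨r, hr, hrU, q, hq⟩ := mem_iInter.1 hx n
    refine ⟨r, hr, hrU, q, fun y hy z hz => le_trans ?_ (hq y hy z hz)⟩
    have : ε n * ‖z - y‖ ≤ δ * ‖z - y‖ :=
      mul_le_mul_of_nonneg_right (by simp only [ε]; linarith) (norm_nonneg _)
    linarith

/-! ### Simons' inequality and norming subspaces -/

theorem exists_near_minimizer {E : Type*} [NormedAddCommGroup E] [NormedSpace ℝ E] {C : Set E}
    (hC : C.Nonempty) (v : E) (t : ℝ) {ε : ℝ} (hε : 0 < ε) :
    ∃ w ∈ C, ∀ c ∈ C, ‖v + t • w‖ ≤ ‖v + t • c‖ + ε := by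
  have hbdd : BddBelow ((fun c => ‖v + t • c‖) '' C) :=
    ⟨0, by rintro _ ⟨c, -, rfl⟩; exact norm_nonneg _⟩
  obtain ⟨_, ⟨w, hw, rfl⟩, hlt⟩ := exists_lt_of_csInf_lt (hC.image fun c => ‖v + t • c‖)
    (lt_add_of_pos_right (sInf ((fun c => ‖v + t • c‖) '' C)) hε)
  refine ⟨w, hw, fun c hc => ?_⟩
  have := csInf_le hbdd ⟨c, hc, rfl⟩
  simp only at hlt this
  linarith

/-- A form of Simons' inequality: if the convex hull of a bounded sequence stays away from `0`,
then there is a vector `v` none of whose norming functionals tends to `0` along the sequence. -/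
theorem exists_forall_norming_not_tendsto {E : Type*} [NormedAddCommGroup E] [NormedSpace ℝ E]
    [CompleteSpace E] {y : ℕ → E} {M m : ℝ} (hM : ∀ n, ‖y n‖ ≤ M) (hm : 0 < m)
    (hconv : ∀ w ∈ convexHull ℝ (range y), m ≤ ‖w‖) :
    ∃ v : E, ∀ b : StrongDual ℝ E, ‖b‖ ≤ 1 → b v = ‖v‖ →
      ¬ Tendsto (fun n => b (y n)) atTop (𝓝 0) := by
  let C : ℕ → Set E := fun n => convexHull ℝ (y '' Ici n)
  have hCne : ∀ n, (C n).Nonempty := fun n =>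
    ⟨y n, subset_convexHull ℝ _ ⟨n, self_mem_Ici, rfl⟩⟩
  have hCanti : ∀ n, C (n + 1) ⊆ C n := fun n =>
    convexHull_mono (image_mono (Ici_subset_Ici.2 n.le_succ))
  have hCM : ∀ n, ∀ c ∈ C n, ‖c‖ ≤ M := fun n c hc => by
    have : C n ⊆ Metric.closedBall 0 M := by
      refine convexHull_min ?_ (convex_closedBall _ _)
      rintro _ ⟨k, -, rfl⟩
      simpa using hM k
    simpa using this hc
  -- `v n` is the partial sum of `∑ (1/2)^(k+1) • w k`, where `w k ∈ C k` almost minimizes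
  -- the norm of `v k + (1/2)^k • w`
  choose sel hselC hselmin using fun (n : ℕ) (v : E) =>
    exists_near_minimizer (hCne n) v ((1 / 2 : ℝ) ^ n)
      (ε := m / 4 * (1 / 4 : ℝ) ^ n) (by positivity)
  let v : ℕ → E := fun n => Nat.rec 0 (fun n v => v + (1 / 2 : ℝ) ^ (n + 1) • sel n v) n
  let w : ℕ → E := fun n => sel n (v n)
  have hv0 : v 0 = 0 := rfl
  have hvs : ∀ n, v (n + 1) = v n + (1 / 2 : ℝ) ^ (n + 1) • w n := fun n => rfl
  have hwC : ∀ n, w n ∈ C n := fun n => hselC n (v n)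
  have htail : ∀ n j, ∀ c ∈ C (n + j), ∃ c' ∈ C n,
      v (n + j) + (1 / 2 : ℝ) ^ (n + j) • c = v n + (1 / 2 : ℝ) ^ n • c' := by
    intro n j
    induction j with
    | zero => exact fun c hc => ⟨c, hc, rfl⟩
    | succ j ih =>
      intro c hc
      obtain ⟨c', hc', h⟩ := ih ((1 / 2 : ℝ) • w (n + j) + (1 / 2 : ℝ) • c)
        (convex_convexHull ℝ _ (hwC _) (hCanti _ hc) (by norm_num) (by norm_num) (by norm_num))
      refine ⟨c', hc', ?_⟩
      rw [← h, ← add_assoc n j 1, hvs, smul_add, smul_smul, smul_smul, ← pow_succ, add_assoc]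
  obtain ⟨V, hV⟩ : ∃ V, Tendsto v atTop (𝓝 V) := by
    refine cauchySeq_tendsto_of_complete (cauchySeq_of_le_geometric (1 / 2) M (by norm_num) ?_)
    intro n
    have hM0 : 0 ≤ M := (norm_nonneg _).trans (hM 0)
    rw [hvs, dist_self_add_right, norm_smul, norm_pow, Real.norm_of_nonneg (by norm_num),
      mul_comm M]
    have h1 : (1 / 2 : ℝ) ^ (n + 1) ≤ (1 / 2 : ℝ) ^ n :=
      pow_le_pow_of_le_one (by norm_num) (by norm_num) n.le_succ
    exact mul_le_mul h1 (hCM n _ (hwC n)) (norm_nonneg _) (by positivity)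
  have hz : ∀ n, Tendsto (fun j => v (n + j) + (1 / 2 : ℝ) ^ (n + j) • w (n + j)) atTop (𝓝 V) := by
    intro n
    have h0 : Tendsto (fun k => (1 / 2 : ℝ) ^ k • w k) atTop (𝓝 0) := by
      refine squeeze_zero_norm (a := fun k => (1 / 2 : ℝ) ^ k * M) (fun k => ?_) ?_
      · rw [norm_smul, norm_pow, Real.norm_of_nonneg (by norm_num)]
        exact mul_le_mul_of_nonneg_left (hCM k _ (hwC k)) (by positivity)
      · simpa using (tendsto_pow_atTop_nhds_zero_of_lt_one (r := (1 / 2 : ℝ)) (by norm_num)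
          (by norm_num)).mul_const M
    have := (hV.add h0).comp (tendsto_add_atTop_nat n)
    simp only [add_zero] at this
    refine this.congr fun j => ?_
    simp only [Function.comp_apply, add_comm j n]
  have hmV : m ≤ ‖V‖ := by
    refine ge_of_tendsto' (hz 0).norm fun j => ?_
    obtain ⟨c, hc, h⟩ := htail 0 j _ (hwC _)
    rw [h, hv0, pow_zero, one_smul, zero_add]
    exact hconv c (convexHull_mono (image_subset_range _ _) hc)
  have hmin : ∀ n, ‖v n + (1 / 2 : ℝ) ^ n • w n‖ ≤ ‖V‖ + m / 4 * (1 / 4 : ℝ) ^ n := by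
    intro n
    refine ge_of_tendsto' ((hz n).norm.add_const _) fun j => ?_
    obtain ⟨c, hc, h⟩ := htail n j _ (hwC _)
    rw [h]
    exact hselmin n (v n) c hc
  refine ⟨V, fun b hb hbV hlim => ?_⟩
  -- near-minimality keeps the weighted tails `2^n * b (V - v n)` above `m / 2`
  have hT : ∀ n, (1 / 2 : ℝ) ^ n * (m / 2 + m / 2 * (1 / 2 : ℝ) ^ n) ≤ b V - b (v n) := by
    intro n
    induction n with
    | zero => rw [hv0, map_zero, hbV]; norm_num; linarith
    | succ n ih =>
      have h1 : b (v n) + (1 / 2 : ℝ) ^ n * b (w n) ≤ b V + m / 4 * (1 / 4 : ℝ) ^ n := by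
        rw [hbV]
        refine le_trans ?_ (hmin n)
        have h2 := (le_abs_self _).trans (b.le_of_opNorm_le hb (v n + (1 / 2 : ℝ) ^ n • w n))
        simpa using h2
      have h4 : (1 / 4 : ℝ) ^ n = (1 / 2 : ℝ) ^ n * (1 / 2 : ℝ) ^ n := by
        rw [← mul_pow]; norm_num
      rw [hvs, map_add, map_smul, smul_eq_mul, pow_succ]
      rw [h4] at h1
      set t := (1 / 2 : ℝ) ^ n
      nlinarith
  obtain ⟨n, hn⟩ := eventually_atTop.1 (hlim.eventually (gt_mem_nhds (show 0 < m / 4 by linarith)))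
  have hCb : ∀ c ∈ C n, b c ≤ m / 4 := by
    have : C n ⊆ {c | b c ≤ m / 4} := by
      refine convexHull_min ?_ (convex_halfSpace_le b.toLinearMap.isLinear _)
      rintro _ ⟨k, hk, rfl⟩
      exact (hn k hk).le
    exact fun c hc => this hc
  have hup : b V ≤ b (v n) + (1 / 2 : ℝ) ^ n * (m / 4) := by
    refine le_of_tendsto' ((b.continuous.tendsto V).comp (hz n)) fun j => ?_
    obtain ⟨c, hc, h⟩ := htail n j _ (hwC _)
    simp only [Function.comp_apply]
    rw [h, map_add, map_smul, smul_eq_mul]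
    have := mul_le_mul_of_nonneg_left (hCb c hc) (show 0 ≤ (1 / 2 : ℝ) ^ n by positivity)
    linarith
  have h1 := hT n
  have h2 : 0 < (1 / 2 : ℝ) ^ n := by positivity
  have h3 : 0 < (1 / 2 : ℝ) ^ n * (m / 4 + m / 2 * (1 / 2 : ℝ) ^ n) := by positivity
  nlinarith

/-- A finite dimensional form of Helly's theorem: finitely many functionals in `W` have a common
zero in the unit ball at which `q` is comparable with its distance to `W`. -/
theorem exists_unitBall_forall_eq_zero {E ι : Type*} [NormedAddCommGroup E] [NormedSpace ℝ E]
    [Finite ι] {W : Submodule ℝ (StrongDual ℝ E)} {q : StrongDual ℝ E} {δ : ℝ} (hδ : 0 < δ)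
    (hq : ∀ p ∈ W, 2 * δ ≤ ‖q - p‖) (w : ι → StrongDual ℝ E) (hw : ∀ i, w i ∈ W) :
    ∃ y : E, ‖y‖ ≤ 1 ∧ (∀ i, w i y = 0) ∧ δ ≤ q y := by
  let N : Submodule ℝ E := ⨅ i, LinearMap.ker (w i).toLinearMap
  have hN : ∀ y : N, ∀ i, w i y = 0 := fun y i => by
    have := (Submodule.mem_iInf _).1 y.2 i
    simpa using this
  by_contra! hcon
  have hle : ∀ y : N, (q.comp N.subtypeL) y ≤ δ * ‖y‖ := by
    refine le_mul_norm_of_sphere one_pos fun y hy => ?_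
    rw [mul_one]
    exact (hcon y (le_of_eq hy) (hN y)).le
  have hnorm : ‖q.comp N.subtypeL‖ ≤ δ := by
    refine ContinuousLinearMap.opNorm_le_bound _ hδ.le fun y => abs_le.2 ⟨?_, hle y⟩
    have := hle (-y)
    rw [map_neg, norm_neg] at this
    linarith
  obtain ⟨p, hp, hpn⟩ := exists_extension_norm_eq N (q.comp N.subtypeL)
  -- `q - p` vanishes on the common kernel, so it is a combination of the `w i`
  have hspan : (q - p).toLinearMap ∈
      Submodule.span ℝ (range fun i => (w i).toLinearMap) := by
    refine mem_span_of_iInf_ker_le_ker fun y hy => ?_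
    have := hp ⟨y, hy⟩
    simp only [LinearMap.mem_ker, ContinuousLinearMap.coe_coe, sub_apply]
    rw [this]
    simp
  have hmem : q - p ∈ W := by
    have hmap : Submodule.span ℝ (range fun i => (w i).toLinearMap) ≤
        W.map (ContinuousLinearMap.coeLM ℝ) := by
      rw [Submodule.span_le]
      rintro _ ⟨i, rfl⟩
      exact ⟨w i, hw i, rfl⟩
    obtain ⟨r, hr, hrq⟩ := hmap hspan
    have : r = q - p := ContinuousLinearMap.coe_injective hrq
    rwa [← this]
  have := hq _ hmem
  rw [sub_sub_cancel, hpn] at this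
  linarith

/-- A closed subspace of the dual generated by a sequence and containing a norming functional of
every vector is the whole dual. -/
theorem closure_span_eq_top_of_norming {E : Type*} [NormedAddCommGroup E] [NormedSpace ℝ E]
    [CompleteSpace E] (w : ℕ → StrongDual ℝ E)
    (h : ∀ v : E, ∃ b ∈ (Submodule.span ℝ (range w)).topologicalClosure, ‖b‖ ≤ 1 ∧ b v = ‖v‖) :
    (Submodule.span ℝ (range w)).topologicalClosure = ⊤ := by
  set W := (Submodule.span ℝ (range w)).topologicalClosure with hW
  by_contra hne
  obtain ⟨q, -, hqW⟩ := SetLike.exists_of_lt (lt_top_iff_ne_top.2 hne)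
  obtain ⟨r, hr, hball⟩ := Metric.isOpen_iff.1
    (Submodule.isClosed_topologicalClosure _ : IsClosed (W : Set (StrongDual ℝ E))).isOpen_compl
    q hqW
  have hdist : ∀ p ∈ W, 2 * (r / 2) ≤ ‖q - p‖ := fun p hp => by
    by_contra! hlt
    have hpb : p ∈ Metric.ball q r := by
      rw [Metric.mem_ball, dist_comm, dist_eq_norm]
      linarith
    exact hball hpb hp
  have hwW : ∀ n, w n ∈ W := fun n =>
    Submodule.le_topologicalClosure _ (Submodule.subset_span (mem_range_self n))
  choose y hy1 hyw hyq using fun n : ℕ => exists_unitBall_forall_eq_zero (half_pos hr) hdist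
    (fun i : Fin n => w i) (fun i => hwW i)
  -- the sequence `y` is bounded and tends to `0` pointwise on `W`, but not weakly
  have hlimW : ∀ p ∈ W, Tendsto (fun n => p (y n)) atTop (𝓝 0) := by
    intro p hp
    rw [Metric.tendsto_atTop]
    intro ε hε
    have hspan : ∀ p ∈ Submodule.span ℝ (range w),
        Tendsto (fun n => p (y n)) atTop (𝓝 0) := by
      intro p hp
      induction hp using Submodule.span_induction with
      | mem x hx =>
        obtain ⟨i, rfl⟩ := hx
        refine tendsto_const_nhds.congr' ?_
        filter_upwards [eventually_gt_atTop i] with n hn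
        exact (hyw n ⟨i, hn⟩).symm
      | zero => simp
      | add a b _ _ ha hb => simpa using ha.add hb
      | smul c a _ ha => simpa using ha.const_mul c
    rw [hW, ← SetLike.mem_coe, Submodule.topologicalClosure_coe, Metric.mem_closure_iff] at hp
    obtain ⟨p', hp', hpp'⟩ := hp (ε / 2) (half_pos hε)
    obtain ⟨N, hN⟩ := Metric.tendsto_atTop.1 (hspan p' hp') (ε / 2) (half_pos hε)
    refine ⟨N, fun n hn => ?_⟩
    have h1 := hN n hn
    rw [dist_zero_right] at h1 ⊢
    have h2 : ‖(p - p') (y n)‖ ≤ ε / 2 := by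
      rw [dist_eq_norm] at hpp'
      refine ((p - p').le_of_opNorm_le hpp'.le (y n)).trans ?_
      exact mul_le_of_le_one_right (by positivity) (hy1 n)
    have h3 : p (y n) = (p - p') (y n) + p' (y n) := by simp
    rw [h3]
    exact (norm_add_le _ _).trans_lt (by linarith)
  have hq0 : 0 < ‖q‖ := norm_pos_iff.2 fun h0 => hqW (h0 ▸ W.zero_mem)
  obtain ⟨v, hv⟩ := exists_forall_norming_not_tendsto (y := y) (m := r / 2 / ‖q‖) hy1
    (by positivity) fun c hc => by
      have hc' : c ∈ {c | r / 2 ≤ q c} := by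
        refine convexHull_min ?_ (convex_halfSpace_ge q.toLinearMap.isLinear _) hc
        rintro _ ⟨n, rfl⟩
        exact hyq n
      rw [div_le_iff₀ hq0, mul_comm]
      exact (hc' : r / 2 ≤ q c).trans ((le_abs_self _).trans (q.le_opNorm c))
  obtain ⟨b, hbW, hb1, hbv⟩ := h v
  exact hv b hb1 hbv (hlimW b hbW)

/-! ### First countable duality mappings -/

/-- A sequence in a compact set all of whose cluster points lie in a first countable set has a
convergent subsequence. -/
theorem exists_subseq_tendsto_of_mapClusterPt_mem {T : Type*} [TopologicalSpace T] [T2Space T]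
    [RegularSpace T] {K J : Set T} (hK : IsCompact K) {u : ℕ → T} (hu : ∀ n, u n ∈ K)
    (hJ : ∀ c, MapClusterPt c atTop u → c ∈ J) [FirstCountableTopology J] :
    ∃ c ∈ K, ∃ s : ℕ → ℕ, StrictMono s ∧ Tendsto (u ∘ s) atTop (𝓝 c) := by
  obtain ⟨c, hcK, hc⟩ : ∃ c ∈ K, MapClusterPt c atTop u :=
    hK (le_principal_iff.2 (eventually_map.2 (Eventually.of_forall hu)))
  obtain ⟨B, hB⟩ := (𝓝 (⟨c, hJ c hc⟩ : J)).exists_antitone_basis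
  -- closed neighbourhoods of `c` that meet `J` in `{c}` only
  have hG : ∀ n, ∃ G ∈ 𝓝 c, IsClosed G ∧ ((↑) : J → T) ⁻¹' G ⊆ B n := fun n => by
    obtain ⟨O, hO, hOB⟩ := mem_nhds_induced _ _ _ |>.1 (hB.1.mem_of_mem (i := n) trivial)
    obtain ⟨G, hG, hGc, hGO⟩ := exists_mem_nhds_isClosed_subset hO
    exact ⟨G, hG, hGc, (preimage_mono hGO).trans hOB⟩
  choose G hGc hGcl hGB using hG
  obtain ⟨s, hs, hsG⟩ := extraction_forall_of_frequently
    (P := fun n k => ∀ m ∈ Finset.range (n + 1), u k ∈ G m) fun n =>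
      hc.frequently ((Filter.biInter_finset_mem (Finset.range (n + 1))).2 fun m _ => hGc m)
        |>.mono fun k hk m hm => mem_iInter₂.1 hk m hm
  refine ⟨c, hcK, s, hs, hK.tendsto_nhds_of_unique_mapClusterPt
    (Eventually.of_forall fun n => hu _) fun a _ ha => ?_⟩
  have haJ : a ∈ J := hJ a (ha.of_comp hs.tendsto_atTop)
  have haG : ∀ m, a ∈ G m := fun m => by
    refine (hGcl m).mem_of_mapClusterPt ha ?_
    filter_upwards [eventually_ge_atTop m] with n hn
    exact hsG n m (Finset.mem_range.2 (Nat.lt_succ_of_le hn))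
  by_contra hne
  have hmem : ({⟨a, haJ⟩}ᶜ : Set J) ∈ 𝓝 (⟨c, hJ c hc⟩ : J) :=
    isOpen_compl_singleton.mem_nhds fun h => hne (Subtype.ext_iff.1 h).symm
  obtain ⟨m, -, hm⟩ := hB.1.mem_iff.1 hmem
  exact hm (hGB m (haG m : (⟨a, haJ⟩ : J) ∈ _)) rfl

theorem apply_eq_of_mapClusterPt {X : Type*} [NormedAddCommGroup X] [NormedSpace ℝ X]
    {u : ℕ → WeakDual ℝ X} {p : WeakDual ℝ X} (hp : MapClusterPt p atTop u) {x : X} {t : ℝ}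
    (ht : Tendsto (fun n => u n x) atTop (𝓝 t)) : p x = t := by
  have h : MapClusterPt (p x) atTop (fun n => u n x) :=
    hp.tendsto_comp ((WeakDual.eval_continuous x).tendsto p)
  have : ClusterPt (p x) (𝓝 t) := ClusterPt.mono h ht
  exact eq_of_nhds_neBot this

/-- If the duality mapping has first countable values, then functionals in the dual unit ball
that almost norm `x` subconverge in the weak-star topology. -/
theorem DualityMapFirstCountablyValued.exists_subseq_tendsto {X : Type*} [NormedAddCommGroup X]
    [NormedSpace ℝ X] (hX : DualityMapFirstCountablyValued X) {x : X} (hx : ‖x‖ = 1)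
    {u : ℕ → StrongDual ℝ X} (hu : ∀ n, ‖u n‖ ≤ 1)
    (hux : Tendsto (fun n => u n x) atTop (𝓝 1)) :
    ∃ p : StrongDual ℝ X, ‖p‖ ≤ 1 ∧ ∃ s : ℕ → ℕ, StrictMono s ∧
      ∀ y, Tendsto (fun n => u (s n) y) atTop (𝓝 (p y)) := by
  have := hX x hx
  have hK := isCompact_dual_unitBall X
  obtain ⟨c, hcK, s, hs, hlim⟩ := exists_subseq_tendsto_of_mapClusterPt_mem
    (J := dualityMap x) hK (u := fun n => StrongDual.toWeakDual (u n)) hu fun c hc => by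
      have hc1 : c x = 1 := apply_eq_of_mapClusterPt hc hux
      have hcK : ‖WeakDual.toStrongDual c‖ ≤ 1 := by
        refine hK.isClosed.mem_of_mapClusterPt hc (Eventually.of_forall hu)
      refine ⟨le_antisymm hcK ?_, hc1⟩
      have := (WeakDual.toStrongDual c).le_opNorm x
      rw [WeakDual.toStrongDual_apply, hc1, hx] at this
      simpa using this
  rw [tendsto_iff_forall_eval_tendsto_topDualPairing] at hlim
  exact ⟨WeakDual.toStrongDual c, hcK, s, hs, hlim⟩

/-- In a Grothendieck space whose duality mapping has first countable values, the norming
functionals of a dense sequence generate, in the norm closed sense, a norming functional of every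
vector; Simons' inequality then shows that they generate the dual. -/
theorem separableSpace_dual_of_dualityMapFirstCountablyValued {X F : Type*}
    [NormedAddCommGroup X] [NormedSpace ℝ X] [NormedAddCommGroup F] [NormedSpace ℝ F]
    [CompleteSpace F] [TopologicalSpace.SeparableSpace F] (i : F →ₗᵢ[ℝ] X)
    (hG : IsGrothendieckSpace X) (hX : DualityMapFirstCountablyValued X) :
    TopologicalSpace.SeparableSpace (StrongDual ℝ F) := by
  choose j hj1 hj using fun y : F => exists_dual_vector'' ℝ (i y)
  let D := TopologicalSpace.denseSeq F
  let w : ℕ → StrongDual ℝ F := fun n => restrictDual i (j (D n))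
  have htop := closure_span_eq_top_of_norming w fun v => by
    rcases eq_or_ne v 0 with rfl | hv
    · exact ⟨0, Submodule.zero_mem _, by simp, by simp⟩
    have hv0 : ‖v‖ ≠ 0 := norm_ne_zero_iff.2 hv
    obtain ⟨a, ha, hlim⟩ := mem_closure_iff_seq_limit.1
      (TopologicalSpace.denseRange_denseSeq F v)
    choose k hk using ha
    have hjv : Tendsto (fun n => j (D (k n)) (i v)) atTop (𝓝 ‖v‖) := by
      have h1 : Tendsto (fun n => j (D (k n)) (i (v - a n))) atTop (𝓝 0) := by
        refine squeeze_zero_norm (a := fun n => ‖v - a n‖) (fun n => ?_) ?_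
        · rw [← i.norm_map (v - a n)]
          exact ((j _).le_of_opNorm_le (hj1 _) _).trans_eq (one_mul _)
        · simpa using (tendsto_const_nhds.sub hlim).norm (a := v - v)
      have h2 := h1.add hlim.norm
      rw [zero_add] at h2
      refine h2.congr fun n => ?_
      have h3 := hj (a n)
      rw [i.norm_map, ← hk n] at h3
      rw [← hk n, map_sub, map_sub]
      have h4 : (j (D (k n))) (i (D (k n))) = ‖D (k n)‖ := h3
      change _ - j (D (k n)) (i (D (k n))) + ‖D (k n)‖ = _
      rw [h4, sub_add_cancel]
    obtain ⟨p, hp1, s, hs', hs⟩ := hX.exists_subseq_tendsto (x := ‖v‖⁻¹ • i v)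
      (by rw [norm_smul, norm_inv, norm_norm, i.norm_map, inv_mul_cancel₀ hv0])
      (u := fun n => j (D (k n))) (fun n => hj1 _) (by
        have := hjv.const_mul ‖v‖⁻¹
        rw [inv_mul_cancel₀ hv0] at this
        simpa using this)
    refine ⟨restrictDual i p, ?_, ?_, ?_⟩
    · -- the weak-star limit is a weak limit
      refine mem_of_tendsto_dual (Submodule.isClosed_topologicalClosure _)
        (u := fun n => w (k (s n)))
        (fun n => Submodule.le_topologicalClosure _ (Submodule.subset_span (mem_range_self _)))
        fun φ => hG.tendsto_bidual hs (φ.comp (restrictDual i))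
    · refine ContinuousLinearMap.opNorm_le_bound _ zero_le_one fun y => ?_
      rw [restrictDual_apply, ← i.norm_map y]
      exact p.le_of_opNorm_le hp1 _
    · exact tendsto_nhds_unique (hs (i v)) (hjv.comp hs'.tendsto_atTop)
  rw [← TopologicalSpace.isSeparable_univ_iff]
  have := isSeparable_closure_span_range w
  rwa [htop] at this

/-! ### Separable duals from the other three conditions -/

theorem isCoseparable_ker {X : Type*} [NormedAddCommGroup X] [NormedSpace ℝ X]
    (e : StrongDual ℝ X) : IsCoseparable (LinearMap.ker e.toLinearMap) := by
  refine ⟨e.isClosed_ker, ?_⟩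
  obtain ⟨a, ha⟩ : ∃ a, ∀ x, ∃ t : ℝ, e x = t * e a := by
    by_cases h : ∃ a, e a ≠ 0
    · obtain ⟨a, ha⟩ := h
      exact ⟨a, fun x => ⟨e x / e a, (div_mul_cancel₀ _ ha).symm⟩⟩
    · push Not at h
      exact ⟨0, fun x => ⟨0, by simp [h]⟩⟩
  have hsurj : Function.Surjective
      fun t : ℝ => (LinearMap.ker e.toLinearMap).mkQ (t • a) := by
    intro y
    obtain ⟨x, rfl⟩ := Submodule.mkQ_surjective _ y
    obtain ⟨t, ht⟩ := ha x
    refine ⟨t, ?_⟩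
    simp only [Submodule.mkQ_apply]
    rw [Submodule.Quotient.eq]
    simp [ht]
  refine hsurj.denseRange.separableSpace ?_
  exact continuous_quot_mk.comp (continuous_id.smul continuous_const)

/-- The unit ball of the annihilator of a suitable coseparable subspace is norm separable and
restricts onto the dual unit ball of `F`. -/
theorem separableSpace_dual_of_coseparableInterStable {X F : Type*}
    [NormedAddCommGroup X] [NormedSpace ℝ X] [NormedAddCommGroup F] [NormedSpace ℝ F]
    [TopologicalSpace.SeparableSpace F] (i : F →ₗᵢ[ℝ] X)
    (hG : IsGrothendieckSpace X) (hX : CoseparableInterStable X) :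
    TopologicalSpace.SeparableSpace (StrongDual ℝ F) := by
  obtain ⟨d, hd1, hd⟩ := exists_seq_dual_unitBall F
  choose e hed he1 using fun n => exists_restrictDual_eq i (d n)
  set Z : Submodule ℝ X := ⨅ n, LinearMap.ker (e n).toLinearMap with hZ
  obtain ⟨-, hZs⟩ := hX _ fun n => isCoseparable_ker (e n)
  let K : Set (WeakDual ℝ X) :=
    {p | ‖WeakDual.toStrongDual p‖ ≤ 1} ∩ {p | ∀ z ∈ Z, p z = 0}
  have hK : IsCompact K := (isCompact_dual_unitBall X).inter_right <| by
    simp only [ofPred_forall]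
    exact isClosed_biInter fun z _ =>
      isClosed_eq (WeakDual.eval_continuous z) continuous_const
  have heK : ∀ n, StrongDual.toWeakDual (e n) ∈ K := fun n =>
    ⟨(he1 n).trans (hd1 n), fun z hz => (Submodule.mem_iInf _).1 hz n⟩
  -- functionals vanishing on `Z` are determined by their values at lifts of a dense sequence
  choose x hx using fun n => Z.mkQ_surjective (TopologicalSpace.denseSeq (X ⧸ Z) n)
  obtain ⟨c, hc⟩ := hG.exists_subset_closure_span hK ⟨_, heK 0⟩ (x := x) fun p hp q hq hpq => by
    have hle : Z ≤ LinearMap.ker (WeakDual.toStrongDual p - WeakDual.toStrongDual q).toLinearMap :=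
      fun z hz => by
        have h1 := hp.2 z hz
        have h2 := hq.2 z hz
        simp [h1, h2]
    let g : X ⧸ Z → ℝ := Z.liftQ _ hle
    have hgc : Continuous g := by
      refine continuous_quot_lift _ ?_
      exact (WeakDual.toStrongDual p - WeakDual.toStrongDual q).continuous
    have hg0 : g = fun _ => 0 := by
      refine hgc.ext_on (TopologicalSpace.denseRange_denseSeq (X ⧸ Z)) continuous_const ?_
      rintro _ ⟨n, rfl⟩
      simp only [← hx n, g]
      simp [hpq n]
    refine DFunLike.ext _ _ fun y => ?_
    have : g (Z.mkQ y) = 0 := congrFun hg0 _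
    simpa [g, sub_eq_zero] using this
  refine separableSpace_dual_of_forall_exists_restrict (i := i) c fun q hq => ?_
  obtain ⟨s, hs⟩ := hd q hq
  obtain ⟨p, hpK, hp⟩ : ∃ p ∈ K, MapClusterPt p atTop fun n => StrongDual.toWeakDual (e (s n)) :=
    hK (le_principal_iff.2 (eventually_map.2 (Eventually.of_forall fun n => heK (s n))))
  refine ⟨WeakDual.toStrongDual p, hc p hpK, ?_⟩
  ext y
  refine apply_eq_of_mapClusterPt hp ((hs y).congr fun n => ?_)
  rw [← hed]
  rfl

/-- The functionals invariant under a contractive projection onto a separable subspace containing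
`F` form a norm separable set that restricts onto the dual unit ball of `F`. -/
theorem separableSpace_dual_of_projection {X F : Type*}
    [NormedAddCommGroup X] [NormedSpace ℝ X] [NormedAddCommGroup F] [NormedSpace ℝ F]
    (i : F →ₗᵢ[ℝ] X) (hG : IsGrothendieckSpace X) {Z : Submodule ℝ X}
    [TopologicalSpace.SeparableSpace Z] (hiZ : ∀ y, i y ∈ Z) {P : X →L[ℝ] X} (hP : ‖P‖ ≤ 1)
    (hPZ : ∀ x, P x ∈ Z) (hPz : ∀ z ∈ Z, P z = z) :
    TopologicalSpace.SeparableSpace (StrongDual ℝ F) := by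
  let K : Set (WeakDual ℝ X) :=
    {p | ‖WeakDual.toStrongDual p‖ ≤ 1} ∩ {p | ∀ x, p (P x) = p x}
  have hK : IsCompact K := (isCompact_dual_unitBall X).inter_right <| by
    simp only [ofPred_forall]
    exact isClosed_iInter fun x =>
      isClosed_eq (WeakDual.eval_continuous (P x)) (WeakDual.eval_continuous x)
  obtain ⟨c, hc⟩ := hG.exists_subset_closure_span hK ⟨0, by simp, fun _ => rfl⟩
    (x := fun n => (TopologicalSpace.denseSeq Z n : X)) fun p hp q hq hpq => by
      have hZ : (fun z : Z => p z) = fun z : Z => q z :=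
        ((map_continuous p).comp continuous_subtype_val).ext_on
          (TopologicalSpace.denseRange_denseSeq Z)
          ((map_continuous q).comp continuous_subtype_val) (by
            rintro _ ⟨n, rfl⟩
            exact hpq n)
      refine DFunLike.ext _ _ fun x => ?_
      rw [← hp.2 x, ← hq.2 x]
      exact congrFun hZ ⟨P x, hPZ x⟩
  refine separableSpace_dual_of_forall_exists_restrict (i := i) c fun q hq => ?_
  obtain ⟨p, hpq, hp⟩ := exists_restrictDual_eq i q
  refine ⟨p.comp P, hc (StrongDual.toWeakDual (p.comp P)) ⟨?_, fun x => ?_⟩, ?_⟩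
  · exact (p.opNorm_comp_le P).trans (mul_le_one₀ (hp.trans hq) (norm_nonneg _) hP)
  · change p (P (P x)) = p (P x)
    rw [hPz _ (hPZ x)]
  · ext y
    rw [← hpq, restrictDual_apply, restrictDual_apply, ContinuousLinearMap.comp_apply,
      hPz _ (hiZ y)]

theorem separableSpace_dual_of_dualBallWeakStarSeqCompact {X F : Type*}
    [NormedAddCommGroup X] [NormedSpace ℝ X] [NormedAddCommGroup F] [NormedSpace ℝ F]
    [TopologicalSpace.SeparableSpace F] (i : F →ₗᵢ[ℝ] X)
    (hG : IsGrothendieckSpace X) (hX : DualBallWeakStarSeqCompact X) :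
    TopologicalSpace.SeparableSpace (StrongDual ℝ F) := by
  obtain ⟨d, hd1, hd⟩ := exists_seq_dual_unitBall F
  choose e hed he1 using fun n => exists_restrictDual_eq i (d n)
  refine separableSpace_dual_of_forall_exists_restrict (i := i) e fun q hq => ?_
  obtain ⟨s, hs⟩ := hd q hq
  obtain ⟨p, -, t, ht, hlim⟩ := hX (x := fun n => StrongDual.toWeakDual (e (s n)))
    fun n => (he1 (s n)).trans (hd1 (s n))
  rw [tendsto_iff_forall_eval_tendsto_topDualPairing] at hlim
  refine ⟨WeakDual.toStrongDual p, mem_of_tendsto_dual (Submodule.isClosed_topologicalClosure _)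
    (u := fun n => e (s (t n)))
    (fun n => Submodule.le_topologicalClosure _ (Submodule.subset_span (mem_range_self _)))
    fun φ => hG.tendsto_bidual (fun y => hlim y) φ, ?_⟩
  ext y
  refine tendsto_nhds_unique (hlim (i y)) (((hs y).comp ht.tendsto_atTop).congr fun n => ?_)
  simp only [Function.comp_apply]
  rw [← hed]
  rfl

/-! ### The dichotomy -/

theorem mainTheorem4 {X : Type*} [NormedAddCommGroup X] [NormedSpace ℝ X] [CompleteSpace X]
    (hdim : ¬ FiniteDimensional ℝ X) (hX : ¬ IsAsplundSpace X)
    (h : DualityMapFirstCountablyValued X ∨ CoseparableInterStable X ∨ OneSCP X ∨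
      DualBallWeakStarSeqCompact X) :
    ∃ z : ℕ → StrongDual ℝ X,
      (∀ k, ‖z k‖ = 1) ∧
      Tendsto (fun k => StrongDual.toWeakDual (z k)) atTop (𝓝 0) ∧
      (0 : StrongDual ℝ X) ∉ closure (convexHull ℝ (range z)) := by
  by_cases hG : IsGrothendieckSpace X
  · refine absurd (isAsplundSpace_of_separable_dual fun Y hYc hYs => ?_) hX
    have : CompleteSpace Y := hYc.completeSpace_coe
    rcases h with h | h | h | h
    · exact separableSpace_dual_of_dualityMapFirstCountablyValued Y.subtypeₗᵢ hG h
    · exact separableSpace_dual_of_coseparableInterStable Y.subtypeₗᵢ hG h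
    · obtain ⟨Z, -, hZs, hYZ, P, hP, hPZ, hPz⟩ := h Y hYc hYs
      exact separableSpace_dual_of_projection Y.subtypeₗᵢ hG (fun y => hYZ y.2) hP hPZ hPz
    · exact separableSpace_dual_of_dualBallWeakStarSeqCompact Y.subtypeₗᵢ hG h
  · exact exists_normalized_of_not_isGrothendieckSpace hG
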